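/- For a partially ordered set $\mathcal P=(X,P)$ on a nonempty finite set $X$, the (Dushnik–Miller) dimension $\dim(\mathcal P)$ is the least positive integer $k$ such that $P$ is the intersection of $k$ linear extensions of $P$, that is, there are linear orders $P_1,\dots,P_k$ on $X$, each containing $P$, with $(x,y)\in P \iff (x,y)\in P_i$ for all $1\le i\le k$. **Corollary.** There is a polynomial-time $O\!\left(\frac{n\sqrt{\log\log n}}{\sqrt{\log n}}\right)$-factor approximation algorithm for the dimension of an $n$-element poset. That is, there are a function $\rho:\mathbb N\to\mathbb R$ with $\rho(n)=O\!\left(\frac{n\sqrt{\log\log n}}{\sqrt{\log n}}\right)$ as $n\to\infty$ and a deterministic polynomial-time algorithm (a program of a unit-cost random access machine with addition and subtraction) which, given any poset $\mathcal P$ on $n\ge 1$ elements by the $n\times n$ matrix of its order relation, outputs an integer $d$ with $$\dim(\mathcal P)\;\le\; d\;\le\;\rho(n)\cdot\dim(\mathcal P).$$ -/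

import Mathlib

/-! ### The Dushnik–Miller dimension of a poset -/

/-- The relation `r` is a linear extension of the partial order of `α`. -/
structure IsLinearExtension (α : Type*) [PartialOrder α] (r : α → α → Prop) : Prop where
  refl : ∀ x, r x x
  antisymm : ∀ x y, r x y → r y x → x = y
  trans : ∀ x y z, r x y → r y z → r x z
  total : ∀ x y, r x y ∨ r y x
  extends_le : ∀ x y, x ≤ y → r x y

/-- The partial order of `α` is the intersection of the `k` linear extensions `L 0, …, L (k - 1)`. -/
def IsRealizer (α : Type*) [PartialOrder α] {k : ℕ} (L : Fin k → α → α → Prop) : Prop :=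
  (∀ i, IsLinearExtension α (L i)) ∧ ∀ x y, x ≤ y ↔ ∀ i, L i x y

/-- The dimension of a poset: the least positive integer `k` such that the partial order is the
intersection of `k` linear extensions. (For a finite poset such a `k` exists, see
`exists_isRealizer`.) -/
noncomputable def posetDim (α : Type*) [PartialOrder α] : ℕ :=
  sInf {k : ℕ | 0 < k ∧ ∃ L : Fin k → α → α → Prop, IsRealizer α L}

/-- If `y ≤ x` fails, then some linear extension puts `x` before `y`. -/
theorem exists_linearExtension {α : Type*} [PartialOrder α] (x y : α) (h : ¬ y ≤ x) :
    ∃ r : α → α → Prop, IsLinearExtension α r ∧ r x y := by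
  let r₀ : α → α → Prop := fun a b => a ≤ b ∨ (a ≤ x ∧ y ≤ b)
  have : IsPartialOrder α r₀ :=
    { refl := fun a => Or.inl le_rfl
      trans := by
        rintro a b c (h1 | ⟨h1, h2⟩) (h3 | ⟨h3, h4⟩)
        · exact Or.inl (h1.trans h3)
        · exact Or.inr ⟨h1.trans h3, h4⟩
        · exact Or.inr ⟨h1, h2.trans h3⟩
        · exact absurd (h2.trans h3) h
      antisymm := by
        rintro a b (h1 | ⟨h1, h2⟩) (h3 | ⟨h3, h4⟩)
        · exact le_antisymm h1 h3
        · exact absurd ((h4.trans h1).trans h3) h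
        · exact absurd ((h2.trans h3).trans h1) h
        · exact absurd (h2.trans h3) h }
  obtain ⟨s, hs, hle⟩ := extend_partialOrder r₀
  exact ⟨s, ⟨fun a => hs.refl a, fun a b => hs.antisymm a b, fun a b c => hs.trans a b c,
    fun a b => hs.total a b, fun a b hab => hle a b (Or.inl hab)⟩, hle x y (Or.inr ⟨le_rfl, le_rfl⟩)⟩

/-- Every finite poset has a realizer, so `posetDim` is attained. -/
theorem exists_isRealizer (α : Type*) [PartialOrder α] [Finite α] :
    ∃ k : ℕ, 0 < k ∧ ∃ L : Fin k → α → α → Prop, IsRealizer α L := by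
  classical
  have hex : ∀ p : α × α, ∃ r : α → α → Prop, IsLinearExtension α r ∧ (¬ p.2 ≤ p.1 → r p.1 p.2) := by
    rintro ⟨x, y⟩
    by_cases h : y ≤ x
    · obtain ⟨s, hs, hle⟩ := extend_partialOrder ((· ≤ ·) : α → α → Prop)
      exact ⟨s, ⟨fun a => hs.refl a, fun a b => hs.antisymm a b, fun a b c => hs.trans a b c,
        fun a b => hs.total a b, fun a b hab => hle a b hab⟩, fun h' => absurd h h'⟩
    · obtain ⟨r, hr, hxy⟩ := exists_linearExtension x y h
      exact ⟨r, hr, fun _ => hxy⟩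
  choose R hR hR' using hex
  rcases isEmpty_or_nonempty α with hα | ⟨⟨a⟩⟩
  · refine ⟨1, one_pos, fun _ _ _ => True, fun _ => ?_, fun x => hα.elim x⟩
    exact ⟨fun x => hα.elim x, fun x => hα.elim x, fun x => hα.elim x, fun x => hα.elim x,
      fun x => hα.elim x⟩
  · obtain ⟨k, ⟨e⟩⟩ := Finite.exists_equiv_fin (α × α)
    refine ⟨k, Fin.pos (e (a, a)), fun i => R (e.symm i), fun i => hR _, fun x y => ?_⟩
    refine ⟨fun h i => (hR _).extends_le x y h, fun h => ?_⟩
    by_contra hxy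
    have h1 := hR' (y, x) hxy
    have h2 : R (e.symm (e (y, x))) x y := h (e (y, x))
    rw [Equiv.symm_apply_apply] at h2
    exact hxy (le_of_eq ((hR _).antisymm x y h2 h1))

/-! ### Random access machines and polynomial time

Programs of a random access machine in structured form. The store consists of variables and
arrays of natural numbers. The arithmetic is addition and truncated subtraction only, so that a
computation of cost `t` produces only numbers of `O(t)` bits beyond those in the input, and unit
costs are polynomially related to the running time of Turing machines. -/

namespace RAM

/-- The contents of the variables and of the arrays. -/
@[ext] structure Store where
  var : ℕ → ℕ
  arr : ℕ → ℕ → ℕ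

/-- Expressions: constants, variables, array entries, sums and truncated differences. -/
inductive Expr where
  | const (c : ℕ)
  | var (x : ℕ)
  | get (a : ℕ) (i : Expr)
  | add (e₁ e₂ : Expr)
  | sub (e₁ e₂ : Expr)

/-- The value of an expression. -/
def Expr.eval (s : Store) : Expr → ℕ
  | .const c => c
  | .var x => s.var x
  | .get a i => s.arr a (i.eval s)
  | .add e₁ e₂ => e₁.eval s + e₂.eval s
  | .sub e₁ e₂ => e₁.eval s - e₂.eval s

/-- The cost of evaluating an expression: one unit for each of its nodes. -/
def Expr.cost : Expr → ℕ
  | .const _ => 1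
  | .var _ => 1
  | .get _ i => i.cost + 1
  | .add e₁ e₂ => e₁.cost + e₂.cost + 1
  | .sub e₁ e₂ => e₁.cost + e₂.cost + 1

/-- Programs. -/
inductive Prog where
  | skip
  | assign (x : ℕ) (e : Expr)
  | put (a : ℕ) (i e : Expr)
  | seq (p q : Prog)
  | cond (e : Expr) (p q : Prog)
  | loop (e : Expr) (p : Prog)

/-- Assignment to the variable `x`. -/
def Store.setVar (s : Store) (x v : ℕ) : Store :=
  { s with var := Function.update s.var x v }

/-- Assignment to the entry `i` of the array `a`. -/
def Store.setArr (s : Store) (a i v : ℕ) : Store :=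
  { s with arr := Function.update s.arr a (Function.update (s.arr a) i v) }

/-- `Exec p s t s'`: the program `p`, started in the store `s`, halts after exactly `t` units of
time in the store `s'`. The test of `cond` and `loop` is whether the value is nonzero. -/
inductive Exec : Prog → Store → ℕ → Store → Prop
  | skip (s : Store) : Exec .skip s 1 s
  | assign (s : Store) (x : ℕ) (e : Expr) :
      Exec (.assign x e) s (e.cost + 1) (s.setVar x (e.eval s))
  | put (s : Store) (a : ℕ) (i e : Expr) :
      Exec (.put a i e) s (i.cost + e.cost + 1) (s.setArr a (i.eval s) (e.eval s))
  | seq {p q : Prog} {s s' s'' : Store} {t t' : ℕ} :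
      Exec p s t s' → Exec q s' t' s'' → Exec (.seq p q) s (t + t') s''
  | cond_true {e : Expr} {p q : Prog} {s s' : Store} {t : ℕ} :
      e.eval s ≠ 0 → Exec p s t s' → Exec (.cond e p q) s (e.cost + 1 + t) s'
  | cond_false {e : Expr} {p q : Prog} {s s' : Store} {t : ℕ} :
      e.eval s = 0 → Exec q s t s' → Exec (.cond e p q) s (e.cost + 1 + t) s'
  | loop_true {e : Expr} {p : Prog} {s s' s'' : Store} {t t' : ℕ} :
      e.eval s ≠ 0 → Exec p s t s' → Exec (.loop e p) s' t' s'' →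
        Exec (.loop e p) s (e.cost + 1 + t + t') s''
  | loop_false {e : Expr} {p : Prog} {s : Store} :
      e.eval s = 0 → Exec (.loop e p) s (e.cost + 1) s

/-- The machine is deterministic. -/
theorem Exec.det {p : Prog} {s s₁ s₂ : Store} {t₁ t₂ : ℕ} (h₁ : Exec p s t₁ s₁)
    (h₂ : Exec p s t₂ s₂) : t₁ = t₂ ∧ s₁ = s₂ := by
  induction h₁ generalizing t₂ s₂ with
  | skip s => cases h₂; exact ⟨rfl, rfl⟩
  | assign s x e => cases h₂; exact ⟨rfl, rfl⟩
  | put s a i e => cases h₂; exact ⟨rfl, rfl⟩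
  | seq _ _ ih ih' =>
    cases h₂ with
    | seq k k' =>
      obtain ⟨rfl, rfl⟩ := ih k
      obtain ⟨rfl, rfl⟩ := ih' k'
      exact ⟨rfl, rfl⟩
  | cond_true he _ ih =>
    cases h₂ with
    | cond_true _ k => obtain ⟨rfl, rfl⟩ := ih k; exact ⟨rfl, rfl⟩
    | cond_false he' _ => exact absurd he' he
  | cond_false he _ ih =>
    cases h₂ with
    | cond_true he' _ => exact absurd he he'
    | cond_false _ k => obtain ⟨rfl, rfl⟩ := ih k; exact ⟨rfl, rfl⟩
  | loop_true he _ _ ih ih' =>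
    cases h₂ with
    | loop_true _ k k' =>
      obtain ⟨rfl, rfl⟩ := ih k
      obtain ⟨rfl, rfl⟩ := ih' k'
      exact ⟨rfl, rfl⟩
    | loop_false he' => exact absurd he' he
  | loop_false he =>
    cases h₂ with
    | loop_true he' _ _ => exact absurd he he'
    | loop_false _ => exact ⟨rfl, rfl⟩

/-- The initial store on the input word `w`: variable `0` holds the length of `w`, array `0` holds
the bits of `w`, everything else is `0`. -/
def input (w : List Bool) : Store where
  var x := if x = 0 then w.length else 0
  arr a i := if a = 0 then (w.getD i false).toNat else 0

/-- The function `f` is computable in polynomial time, where its arguments are presented as words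
over `{0, 1}` by `enc`: one program halts, on every input, within a number of steps polynomial in
the length of the input word, with the value of `f` in variable `0`. -/
def PolyTimeComputable {α : Type*} (enc : α → List Bool) (f : α → ℕ) : Prop :=
  ∃ (p : Prog) (T : Polynomial ℕ), ∀ a : α, ∃ (t : ℕ) (s : Store),
    Exec p (input (enc a)) t s ∧ t ≤ T.eval (enc a).length ∧ s.var 0 = f a

end RAM

/-! ### Finite posets as inputs of an algorithm -/

/-- A nonempty finite poset, with its elements labelled `0, …, card - 1`. -/
structure FinitePoset where
  card : ℕ
  card_pos : 0 < card
  order : PartialOrder (Fin card)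

namespace FinitePoset

/-- The dimension of a finite poset. -/
noncomputable def dim (P : FinitePoset) : ℕ :=
  @posetDim (Fin P.card) P.order

open Classical in
/-- A poset on `n` elements is written as the word `1ⁿ0` followed by the `n * n` bits of the matrix
of its order relation, row by row. -/
noncomputable def encode (P : FinitePoset) : List Bool :=
  List.replicate P.card true ++ false ::
    (List.finRange P.card).flatMap fun i =>
      (List.finRange P.card).map fun j => decide (P.order.le i j)

end FinitePoset

/-! Let `N` be the length of the input word, about `n²`, and cut the poset into blocks of `k`
elements with `k ≈ √(log N / log log N)`. A pair `x ≰ y` is reversed by a linear extension that puts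
`y` before `x`; a family of extensions is a realizer once it reverses all such pairs. To reverse
pairs starting in a given block, only ranks on the block matter: ordering the poset by the largest
rank found below each element reverses `(x, y)` whenever all block members below `y` rank lower than
`x` (`exists_linearExtension_of_rank`).

So for each block the least number of rank functions that reverses all its pairs can be found by
exhaustive search. Ranks need `w ≈ log log N` bits and `k` functions always suffice, so there are `2
^ (w * k²) ≤ N` codes to try. The least number is at most `dim`, since a realizer restricts to ranks
(`blockGood_dim`), and the functions of all blocks together yield a realizer (`dim_le_approxDim`).
With about `n / k` blocks the total is within a factor `n / k + 2` of `dim` (`approxDim_le`), which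
is the required order (`ratio_isBigO`).

For the machine, the answer is written as a term with sums cut off at `N`. Each such term compiles
to a polynomial-time program (`exec_compile`); quantifiers, minima, quotients and roots all become
counting. -/

namespace RAM

/-! ### Terms with bounded sums and their compilation -/

/-- Terms: expressions extended by bounded sums. `sum x e t` is the sum of the values of `t` as the
variable `x + 1` runs through the numbers less than both `e` and the variable `0`. -/
inductive Term where
  | const (c : ℕ)
  | var (x : ℕ)
  | get (a : ℕ) (t : Term)
  | add (t u : Term)
  | sub (t u : Term)
  | sum (x : ℕ) (e t : Term)

namespace Term

/-- The value of a term. -/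
def eval : Term → Store → ℕ
  | const c, _ => c
  | var x, s => s.var x
  | get a t, s => s.arr a (t.eval s)
  | add t u, s => t.eval s + u.eval s
  | sub t u, s => t.eval s - u.eval s
  | sum x e t, s => ∑ i ∈ Finset.range (min (e.eval s) (s.var 0)), t.eval (s.setVar (x + 1) i)

/-- A positive number above all variables of a term. -/
def bd : Term → ℕ
  | const _ => 1
  | var x => x + 1
  | get _ t => t.bd
  | add t u => max t.bd u.bd
  | sub t u => max t.bd u.bd
  | sum x e t => max (x + 2) (max e.bd t.bd)

/-- A program that writes the value of a term into the variable `d` and otherwise changes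
variables above `d` only. -/
def compile : Term → ℕ → Prog
  | const c, d => .assign d (.const c)
  | var x, d => .assign d (.var x)
  | get a t, d => .seq (t.compile d) (.assign d (.get a (.var d)))
  | add t u, d => .seq (t.compile d) (.seq (u.compile (d + 1))
      (.assign d (.add (.var d) (.var (d + 1)))))
  | sub t u, d => .seq (t.compile d) (.seq (u.compile (d + 1))
      (.assign d (.sub (.var d) (.var (d + 1)))))
  | sum x e t, d =>
    .seq (e.compile d) <|
    -- With truncated subtraction `a - (a - b) = min a b`, so variable `d + 1` counts down from the
    -- bound cut off at variable `0`.
    .seq (.assign (d + 1) (.sub (.var d) (.sub (.var d) (.var 0)))) <|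
    .seq (.assign d (.const 0)) <|
    -- The outer value of the summation variable is saved here and restored after the loop.
    .seq (.assign (d + 2) (.var (x + 1))) <|
    .seq (.assign (x + 1) (.const 0)) <|
    .seq (.loop (.var (d + 1)) <|
      .seq (t.compile (d + 3)) <|
      .seq (.assign d (.add (.var d) (.var (d + 3)))) <|
      .seq (.assign (x + 1) (.add (.var (x + 1)) (.const 1))) <|
      .assign (d + 1) (.sub (.var (d + 1)) (.const 1))) <|
    .assign (x + 1) (.var (d + 2))

open Polynomial in
/-- A bound on the running time of `compile` as a polynomial in the variable `0`. -/
noncomputable def cost : Term → Polynomial ℕ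
  | const _ => 2
  | var _ => 2
  | get _ t => t.cost + 3
  | add t u => t.cost + u.cost + 4
  | sub t u => t.cost + u.cost + 4
  | sum _ e t => e.cost + X * (t.cost + 14) + 20

end Term

@[simp] theorem Store.setVar_arr (s : Store) (x v : ℕ) : (s.setVar x v).arr = s.arr := rfl

theorem Store.setVar_var (s : Store) (x v y : ℕ) :
    (s.setVar x v).var y = if y = x then v else s.var y := by
  simp [Store.setVar, Function.update_apply]

namespace Term

theorem bd_pos : ∀ t : Term, 0 < t.bd
  | const _ => by simp [bd]
  | var _ => by simp [bd]
  | get _ t => by simpa [bd] using t.bd_pos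
  | add t u => by simp [bd, t.bd_pos]
  | sub t u => by simp [bd, t.bd_pos]
  | sum x e t => by simp [bd]

/-- The value of a term depends only on the arrays and on the variables below `bd`. -/
theorem eval_congr (t : Term) {s s' : Store} (ha : s.arr = s'.arr)
    (hv : ∀ x < t.bd, s.var x = s'.var x) : t.eval s = t.eval s' := by
  induction t generalizing s s' with
  | const c => rfl
  | var x => exact hv x (by simp [bd])
  | get a t ih => simp only [eval, ha, ih ha hv]
  | add t u iht ihu =>
    simp only [eval, iht ha fun x hx => hv x (lt_max_of_lt_left hx),
      ihu ha fun x hx => hv x (lt_max_of_lt_right hx)]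
  | sub t u iht ihu =>
    simp only [eval, iht ha fun x hx => hv x (lt_max_of_lt_left hx),
      ihu ha fun x hx => hv x (lt_max_of_lt_right hx)]
  | sum x e t ihe iht =>
    simp only [eval]
    rw [ihe ha fun y hy => hv y (by simp [bd, hy]), hv 0 (by simp [bd])]
    refine Finset.sum_congr rfl fun i _ => iht (by simpa using ha) fun y hy => ?_
    rw [Store.setVar_var, Store.setVar_var, hv y (by simp [bd, hy])]

theorem eval_setVar (t : Term) (s : Store) {x : ℕ} (hx : t.bd ≤ x) (v : ℕ) :
    t.eval (s.setVar x v) = t.eval s :=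
  t.eval_congr rfl fun y hy => by rw [Store.setVar_var, if_neg (by omega)]

/-- Scratch space lies above `d`, so a first operand stored in `d` survives the evaluation of the
second at `d + 1`. Every loop makes at most `s.var 0` rounds whatever the value of its bound, which
keeps the cost polynomial. -/
theorem exec_compile (t : Term) (s : Store) (d : ℕ) (hd : t.bd ≤ d) :
    ∃ (m : ℕ) (s' : Store), Exec (t.compile d) s m s' ∧ m ≤ t.cost.eval (s.var 0) ∧
      s'.arr = s.arr ∧ (∀ x < d, s'.var x = s.var x) ∧ s'.var d = t.eval s := by
  induction t generalizing s d with
  | const c =>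
    refine ⟨_, _, .assign s d (.const c), by simp [cost, Expr.cost], rfl, fun x hx => ?_, ?_⟩
    · rw [Store.setVar_var, if_neg hx.ne]
    · rw [Store.setVar_var, if_pos rfl]; rfl
  | var x =>
    refine ⟨_, _, .assign s d (.var x), by simp [cost, Expr.cost], rfl, fun x hx => ?_, ?_⟩
    · rw [Store.setVar_var, if_neg hx.ne]
    · rw [Store.setVar_var, if_pos rfl]; rfl
  | get a t ih =>
    obtain ⟨m, s', he, hm, ha, hv, hr⟩ := ih s d hd
    refine ⟨_, _, .seq he (.assign s' d _), ?_, ha, fun x hx => ?_, ?_⟩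
    · simp only [cost, Polynomial.eval_add, Polynomial.eval_ofNat, Expr.cost]; omega
    · rw [Store.setVar_var, if_neg hx.ne, hv x hx]
    · rw [Store.setVar_var, if_pos rfl]; simp only [Expr.eval, eval, hr, ha]
  | add t u iht ihu =>
    obtain ⟨m, s', he, hm, ha, hv, hr⟩ := iht s d ((le_max_left _ _).trans hd)
    have hu : u.bd ≤ d := (le_max_right _ _).trans hd
    obtain ⟨m', s'', he', hm', ha', hv', hr'⟩ := ihu s' (d + 1) (by omega)
    have h0 : s'.var 0 = s.var 0 := hv 0 (u.bd_pos.trans_le hu)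
    refine ⟨_, _, .seq he (.seq he' (.assign s'' d _)), ?_, ha'.trans ha, fun x hx => ?_, ?_⟩
    · rw [h0] at hm'
      simp only [cost, Polynomial.eval_add, Polynomial.eval_ofNat, Expr.cost]; omega
    · rw [Store.setVar_var, if_neg hx.ne, hv' x (by omega), hv x hx]
    · rw [Store.setVar_var, if_pos rfl]
      simp only [Expr.eval, eval, hr', hv' d (by omega), hr]
      rw [u.eval_congr ha fun x hx => hv x (by omega)]
  | sub t u iht ihu =>
    obtain ⟨m, s', he, hm, ha, hv, hr⟩ := iht s d ((le_max_left _ _).trans hd)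
    have hu : u.bd ≤ d := (le_max_right _ _).trans hd
    obtain ⟨m', s'', he', hm', ha', hv', hr'⟩ := ihu s' (d + 1) (by omega)
    have h0 : s'.var 0 = s.var 0 := hv 0 (u.bd_pos.trans_le hu)
    refine ⟨_, _, .seq he (.seq he' (.assign s'' d _)), ?_, ha'.trans ha, fun x hx => ?_, ?_⟩
    · rw [h0] at hm'
      simp only [cost, Polynomial.eval_add, Polynomial.eval_ofNat, Expr.cost]; omega
    · rw [Store.setVar_var, if_neg hx.ne, hv' x (by omega), hv x hx]
    · rw [Store.setVar_var, if_pos rfl]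
      simp only [Expr.eval, eval, hr', hv' d (by omega), hr]
      rw [u.eval_congr ha fun x hx => hv x (by omega)]
  | sum x e t ihe iht =>
    have hxd : x + 2 ≤ d := (le_max_left _ _).trans hd
    have hed : e.bd ≤ d := ((le_max_left _ _).trans (le_max_right _ _)).trans hd
    have htd : t.bd ≤ d := ((le_max_right _ _).trans (le_max_right _ _)).trans hd
    obtain ⟨m, s', he, hm, ha, hv, hr⟩ := ihe s d hed
    -- Loop invariant: `j` rounds remain, `i` is the current index, `d` accumulates, `d + 2` keeps
    -- the saved value. A round costs 14 units besides the evaluation of `t`.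
    have loop : ∀ (j i : ℕ) (u : Store), u.arr = s.arr →
        (∀ y < d, y ≠ x + 1 → u.var y = s.var y) → u.var (x + 1) = i → u.var (d + 1) = j →
        u.var (d + 2) = s.var (x + 1) →
        ∃ (m : ℕ) (u' : Store), Exec (.loop (.var (d + 1)) <|
          .seq (t.compile (d + 3)) <|
          .seq (.assign d (.add (.var d) (.var (d + 3)))) <|
          .seq (.assign (x + 1) (.add (.var (x + 1)) (.const 1))) <|
          .assign (d + 1) (.sub (.var (d + 1)) (.const 1))) u m u' ∧
          m ≤ j * (t.cost.eval (s.var 0) + 14) + 2 ∧ u'.arr = s.arr ∧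
          (∀ y < d, y ≠ x + 1 → u'.var y = s.var y) ∧ u'.var (d + 2) = s.var (x + 1) ∧
          u'.var d = u.var d + ∑ l ∈ Finset.range j, t.eval (s.setVar (x + 1) (i + l)) := by
      intro j
      induction j with
      | zero =>
        intro i u hua huv _ huj hus
        exact ⟨_, u, .loop_false (by simpa [Expr.eval] using huj), by simp [Expr.cost], hua, huv,
          hus, by simp⟩
      | succ j ih =>
        intro i u hua huv hui huj hus
        obtain ⟨m₁, u₁, h₁, hm₁, ha₁, hv₁, hr₁⟩ := iht u (d + 3) (by omega)
        have hval : t.eval u = t.eval (s.setVar (x + 1) i) := by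
          refine t.eval_congr hua fun y hy => ?_
          rw [Store.setVar_var]
          split_ifs with h
          · rw [h, hui]
          · exact huv y (by omega) h
        have hu0 : u.var 0 = s.var 0 := huv 0 (by omega) (by omega)
        obtain ⟨m₂, u₂, h₂, hm₂, ha₂, hv₂, hs₂, hr₂⟩ := ih (i + 1)
          (((u₁.setVar d (u₁.var d + u₁.var (d + 3))).setVar (x + 1) (i + 1)).setVar (d + 1) j)
          (by simp [ha₁, hua])
          (fun y hy hyx => by
            rw [Store.setVar_var, if_neg (by omega), Store.setVar_var, if_neg hyx,
              Store.setVar_var, if_neg (by omega), hv₁ y (by omega), huv y hy hyx])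
          (by rw [Store.setVar_var, if_neg (by omega), Store.setVar_var, if_pos rfl])
          (by rw [Store.setVar_var, if_pos rfl])
          (by rw [Store.setVar_var, if_neg (by omega), Store.setVar_var, if_neg (by omega),
              Store.setVar_var, if_neg (by omega), hv₁ _ (by omega), hus])
        refine ⟨_, u₂, .loop_true (t' := m₂) (by simp [Expr.eval, huj])
          (.seq h₁ (.seq (.assign _ _ _) (.seq (.assign _ _ _) (.assign _ _ _)))) ?_, ?_, ha₂, hv₂,
          hs₂, ?_⟩
        · have e1 : u₁.var (x + 1) = i := by rw [hv₁ _ (by omega), hui]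
          have e2 : u₁.var (d + 1) = j + 1 := by rw [hv₁ _ (by omega), huj]
          simpa [Expr.eval, Store.setVar_var, e1, e2, show x + 1 ≠ d by omega,
            show d + 1 ≠ x + 1 by omega, show d ≠ x by omega] using h₂
        · rw [hu0] at hm₁
          simp only [Expr.cost, Nat.add_mul, Nat.one_mul] at hm₂ ⊢
          omega
        · rw [hr₂, Finset.sum_range_succ', Store.setVar_var, if_neg (by omega), Store.setVar_var,
            if_neg (by omega), Store.setVar_var, if_pos rfl, hr₁, hval, hv₁ d (by omega)]
          simp only [add_zero, Nat.add_assoc, Nat.add_comm 1]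
          omega
    have h0 : s'.var 0 = s.var 0 := hv 0 (by omega)
    have hmin : s'.var d - (s'.var d - s'.var 0) = min (e.eval s) (s.var 0) := by
      rw [hr, h0]; omega
    obtain ⟨m₂, u, h₂, hm₂, ha₂, hv₂, hs₂, hr₂⟩ := loop (min (e.eval s) (s.var 0)) 0
      ((((s'.setVar (d + 1) (min (e.eval s) (s.var 0))).setVar d 0).setVar (d + 2)
        (s.var (x + 1))).setVar (x + 1) 0) (by simp [ha])
        (fun y hy hyx => by
          rw [Store.setVar_var, if_neg hyx, Store.setVar_var, if_neg (by omega),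
            Store.setVar_var, if_neg (by omega), Store.setVar_var, if_neg (by omega), hv y hy])
        (by rw [Store.setVar_var, if_pos rfl])
        (by rw [Store.setVar_var, if_neg (by omega), Store.setVar_var, if_neg (by omega),
            Store.setVar_var, if_neg (by omega), Store.setVar_var, if_pos rfl])
        (by rw [Store.setVar_var, if_neg (by omega), Store.setVar_var, if_pos rfl])
    refine ⟨_, _, .seq he (.seq (.assign _ _ _) (.seq (.assign _ _ _) (.seq (.assign _ _ _)
      (.seq (.assign _ _ _) (.seq (t := m₂) (s' := u) ?_ (.assign _ _ _)))))), ?_, ha₂,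
      fun y hy => ?_, ?_⟩
    · have e1 : s'.var (x + 1) = s.var (x + 1) := hv _ (by omega)
      simpa [Expr.eval, Store.setVar_var, hmin, e1, show x + 1 ≠ d by omega,
        show x ≠ d by omega] using h₂
    · simp only [cost, Polynomial.eval_add, Polynomial.eval_ofNat, Polynomial.eval_mul,
        Polynomial.eval_X, Expr.cost]
      have := Nat.mul_le_mul_right (t.cost.eval (s.var 0) + 14) (min_le_right (e.eval s) (s.var 0))
      omega
    · rw [Store.setVar_var]
      split_ifs with h
      · rw [h]; exact hs₂
      · exact hv₂ y hy h
    · rw [Store.setVar_var, if_neg (by omega), hr₂, Store.setVar_var, if_neg (by omega),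
        Store.setVar_var, if_neg (by omega), Store.setVar_var, if_pos rfl]
      simp [eval]

/-- A program that assigns the value of a term to a variable. -/
def assignProg (x : ℕ) (t : Term) (d : ℕ) : Prog := .seq (t.compile d) (.assign x (.var d))

theorem exec_assignProg (x : ℕ) (t : Term) (s : Store) (d : ℕ) (hd : t.bd ≤ d) :
    ∃ (m : ℕ) (s' : Store), Exec (assignProg x t d) s m s' ∧ m ≤ t.cost.eval (s.var 0) + 2 ∧
      s'.arr = s.arr ∧ (∀ y < d, y ≠ x → s'.var y = s.var y) ∧ s'.var x = t.eval s := by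
  obtain ⟨m, s', he, hm, ha, hv, hr⟩ := t.exec_compile s d hd
  refine ⟨_, _, .seq he (.assign s' x (.var d)), ?_, ha, fun y hy hyx => ?_, ?_⟩
  · simp only [Expr.cost]; omega
  · rw [Store.setVar_var, if_neg hyx, hv y hy]
  · rw [Store.setVar_var, if_pos rfl]; exact hr

/-! ### Arithmetic and bounded logic as terms -/

/-- The product of two terms, the first of which is at most the variable `0`. -/
def mul (t u : Term) : Term := sum u.bd t u

/-- The summation variable `u.bd + 1` is fresh for `u`, so the summand is constant; the hypothesis
prevents the cut-off at variable `0`. -/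
theorem eval_mul (t u : Term) (s : Store) (h : t.eval s ≤ s.var 0) :
    (mul t u).eval s = t.eval s * u.eval s := by
  simp [mul, eval, u.eval_setVar s (Nat.le_succ _), min_eq_left h]

open Classical in
/-- The term `t` has the truth value of `φ`. -/
def Holds (t : Term) (s : Store) (φ : Prop) : Prop := t.eval s = if φ then 1 else 0

/-- Comparison. -/
def le (t u : Term) : Term := sub (const 1) (sub t u)

theorem holds_le (t u : Term) (s : Store) : (le t u).Holds s (t.eval s ≤ u.eval s) := by
  simp only [Holds, le, eval]; split_ifs <;> omega

/-- Strict comparison. -/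
def lt (t u : Term) : Term := le (add t (const 1)) u

theorem holds_lt (t u : Term) (s : Store) : (lt t u).Holds s (t.eval s < u.eval s) :=
  holds_le _ _ _

/-- Negation. -/
def not (t : Term) : Term := sub (const 1) t

theorem Holds.not {t : Term} {s : Store} {φ : Prop} (h : t.Holds s φ) :
    t.not.Holds s (¬ φ) := by
  unfold Holds at *
  simp only [Term.not, eval, h]; split_ifs <;> simp

/-- Implication. -/
def imp (t u : Term) : Term := le t u

/-- The conclusion need be evaluated correctly only when the premise holds. This lets an index check
guard an array lookup that is meaningless out of range. -/
theorem Holds.imp {t u : Term} {s : Store} {φ ψ : Prop} (h : t.Holds s φ) (h' : φ → u.Holds s ψ) :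
    (t.imp u).Holds s (φ → ψ) := by
  unfold Holds at *
  by_cases hφ : φ
  · simp only [Term.imp, le, eval, h, h' hφ]; split_ifs <;> simp_all
  · simp [Term.imp, le, eval, h, hφ]

/-- The number of `i` below `e` with the property `t`. -/
theorem eval_sum_of_holds {x : ℕ} {e t : Term} {s : Store} {φ : ℕ → Prop} [DecidablePred φ]
    {m : ℕ} (hm : min (e.eval s) (s.var 0) = m)
    (h : ∀ i < m, t.Holds (s.setVar (x + 1) i) (φ i)) :
    (sum x e t).eval s = ((Finset.range m).filter φ).card := by
  simp only [eval, hm, Finset.card_filter]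
  refine Finset.sum_congr rfl fun i hi => (h i (Finset.mem_range.1 hi)).trans ?_
  congr

/-- Bounded existential quantification over the variable `x + 1`. -/
def ex (x : ℕ) (e t : Term) : Term := le (const 1) (sum x e t)

theorem Holds.ex {x : ℕ} {e t : Term} {s : Store} {φ : ℕ → Prop} {m : ℕ}
    (hm : min (e.eval s) (s.var 0) = m)
    (h : ∀ i < m, t.Holds (s.setVar (x + 1) i) (φ i)) :
    (Term.ex x e t).Holds s (∃ i < m, φ i) := by
  classical
  have key : (const 1).eval s ≤ (sum x e t).eval s ↔ ∃ i < m, φ i := by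
    rw [eval_sum_of_holds hm h]
    simp [eval, Nat.one_le_iff_ne_zero, Finset.filter_eq_empty_iff]
  rw [← propext key]
  exact holds_le _ _ s

/-- Bounded universal quantification over the variable `x + 1`. -/
def all (x : ℕ) (e t : Term) : Term := (ex x e t.not).not

theorem Holds.all {x : ℕ} {e t : Term} {s : Store} {φ : ℕ → Prop} {m : ℕ}
    (hm : min (e.eval s) (s.var 0) = m)
    (h : ∀ i < m, t.Holds (s.setVar (x + 1) i) (φ i)) :
    (Term.all x e t).Holds s (∀ i < m, φ i) := by
  have := (Holds.ex hm fun i hi => (h i hi).not).not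
  simpa [Term.all] using this

/-- The quotient of two terms, the second of which is positive. -/
def div (t u : Term) : Term :=
  sum (max t.bd u.bd) t (le (mul (add (var (max t.bd u.bd + 1)) (const 1)) u) t)

/-- The quotient is the number of `i` with `(i + 1) * u ≤ t`. -/
theorem eval_div (t u : Term) (s : Store) (h : t.eval s ≤ s.var 0) (hu : 0 < u.eval s) :
    (div t u).eval s = t.eval s / u.eval s := by
  rw [div, eval_sum_of_holds (m := t.eval s) (φ := fun i => (i + 1) * u.eval s ≤ t.eval s)
    (min_eq_left h)]
  · have : (Finset.range (t.eval s)).filter (fun i => (i + 1) * u.eval s ≤ t.eval s) =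
        Finset.range (t.eval s / u.eval s) := by
      ext i
      rw [Finset.mem_filter, Finset.mem_range, Finset.mem_range, ← Nat.le_div_iff_mul_le hu]
      have := Nat.div_le_self (t.eval s) (u.eval s)
      omega
    rw [this, Finset.card_range]
  · intro i hi
    have h1 : u.eval (s.setVar (max t.bd u.bd + 1) i) = u.eval s := u.eval_setVar s (by omega) i
    have h2 : t.eval (s.setVar (max t.bd u.bd + 1) i) = t.eval s := t.eval_setVar s (by omega) i
    have := holds_le (mul (add (var (max t.bd u.bd + 1)) (const 1)) u) t
      (s.setVar (max t.bd u.bd + 1) i)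
    rw [eval_mul _ _ _ (by simp [eval, Store.setVar_var]; omega), h1, h2] at this
    simpa [eval, Store.setVar_var] using this

/-- The remainder of the division of two terms. -/
def mod (t u : Term) : Term := sub t (mul (div t u) u)

theorem eval_mod (t u : Term) (s : Store) (h : t.eval s ≤ s.var 0) (hu : 0 < u.eval s) :
    (mod t u).eval s = t.eval s % u.eval s := by
  have h1 := eval_div t u s h hu
  have h2 := Nat.div_le_self (t.eval s) (u.eval s)
  rw [mod, eval, eval_mul _ _ _ (by omega), h1, Nat.mod_eq_sub_div_mul]

end Term

/-! ### Table of powers of two -/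

/-- A program that tabulates powers of two in the array `1`. -/
def powTable : Prog :=
  .seq (.put 1 (.const 0) (.const 1)) <|
  .seq (.assign 1 (.const 0)) <|
  .loop (.sub (.var 0) (.var 1)) <|
  .seq (.put 1 (.add (.var 1) (.const 1)) (.add (.get 1 (.var 1)) (.get 1 (.var 1)))) <|
  .assign 1 (.add (.var 1) (.const 1))

/-- Repeated doubling needs only addition. The table later supplies binary lengths and the weights
for extracting digits. -/
theorem exec_powTable (s : Store) :
    ∃ (m : ℕ) (s' : Store), Exec powTable s m s' ∧ m ≤ 20 * s.var 0 + 20 ∧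
      s'.arr 0 = s.arr 0 ∧ (∀ j ≤ s.var 0, s'.arr 1 j = 2 ^ j) ∧ s'.var 0 = s.var 0 := by
  have loop : ∀ (j : ℕ) (u : Store), u.arr 0 = s.arr 0 → u.var 0 = s.var 0 →
      u.var 1 + j = s.var 0 → (∀ i ≤ u.var 1, u.arr 1 i = 2 ^ i) →
      ∃ (m : ℕ) (u' : Store), Exec (.loop (.sub (.var 0) (.var 1)) <|
        .seq (.put 1 (.add (.var 1) (.const 1)) (.add (.get 1 (.var 1)) (.get 1 (.var 1)))) <|
        .assign 1 (.add (.var 1) (.const 1))) u m u' ∧ m ≤ 20 * j + 4 ∧ u'.arr 0 = s.arr 0 ∧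
        (∀ i ≤ s.var 0, u'.arr 1 i = 2 ^ i) ∧ u'.var 0 = s.var 0 := by
    intro j
    induction j with
    | zero =>
      intro u h0 hv h1 h2
      exact ⟨_, u, .loop_false (by simp [Expr.eval]; omega), by simp [Expr.cost], h0,
        fun i hi => h2 i (by omega), hv⟩
    | succ j ih =>
      intro u h0 hv h1 h2
      obtain ⟨m, u', he, hm, h⟩ := ih ((u.setArr 1 (u.var 1 + 1)
        (u.arr 1 (u.var 1) + u.arr 1 (u.var 1))).setVar 1 (u.var 1 + 1))
        (by simpa [Store.setArr] using h0) (by simpa [Store.setVar_var, Store.setArr] using hv)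
        (by simp [Store.setVar_var]; omega)
        (by
          intro i hi
          simp only [Store.setVar_var, if_true] at hi
          simp only [Store.setVar_arr, Store.setArr, Function.update_self]
          rcases eq_or_ne i (u.var 1 + 1) with rfl | hne
          · rw [Function.update_self, h2 _ le_rfl, pow_succ, mul_two]
          · rw [Function.update_of_ne hne, h2 i (by omega)])
      refine ⟨_, u', .loop_true (by simp [Expr.eval]; omega) (.seq (.put _ _ _ _) (.assign _ _ _))
        he, ?_, h⟩
      simp only [Expr.cost]
      omega
  obtain ⟨m, u, he, hm, h⟩ := loop (s.var 0) ((s.setArr 1 0 1).setVar 1 0)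
    (by simp [Store.setArr]) (by simp [Store.setVar_var, Store.setArr])
    (by simp [Store.setVar_var])
    (by
      intro i hi
      simp only [Store.setVar_var, if_true, Nat.le_zero] at hi
      simp [Store.setArr, hi])
  refine ⟨_, u, .seq (.put _ _ _ _) (.seq (.assign _ _ _) he), ?_, h⟩
  simp only [Expr.cost]
  omega

end RAM

/-! ### Linear extensions from ranks, and digit codes -/

/-- A monotone function built from arbitrary values on a family of elements gives a linear extension
that puts `y` before `e b` as soon as all members of the family below `y` have smaller values. -/
theorem exists_linearExtension_of_rank {α β : Type*} [PartialOrder α] [Fintype β] (e : β → α)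
    (r : β → ℕ) : ∃ L : α → α → Prop, IsLinearExtension α L ∧
      ∀ b y, (∀ b', e b' ≤ y → r b' < r b) → ¬ L (e b) y := by
  classical
  obtain ⟨s, hs, hle⟩ := extend_partialOrder ((· ≤ ·) : α → α → Prop)
  -- The `+ 1` separates elements above no member of the family from those above a member of rank
  -- `0`.
  let h : α → ℕ := fun y => (Finset.univ.filter fun b => e b ≤ y).sup fun b => r b + 1
  have hmono : ∀ x y, x ≤ y → h x ≤ h y := fun x y hxy =>
    Finset.sup_mono fun b hb => by
      rw [Finset.mem_filter] at hb ⊢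
      exact ⟨hb.1, hb.2.trans hxy⟩
  -- Order by `h`, breaking ties by an arbitrary linear extension `s`.
  refine ⟨fun x y => h x < h y ∨ h x = h y ∧ s x y, ⟨fun x => Or.inr ⟨rfl, hs.refl x⟩, ?_, ?_, ?_,
    fun x y hxy => (hmono x y hxy).lt_or_eq.imp id fun hh => ⟨hh, hle x y hxy⟩⟩, ?_⟩
  · rintro x y (h1 | ⟨h1, h2⟩) (h3 | ⟨h3, h4⟩)
    · omega
    · omega
    · omega
    · exact hs.antisymm x y h2 h4
  · rintro x y z (h1 | ⟨h1, h2⟩) (h3 | ⟨h3, h4⟩)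
    · exact Or.inl (h1.trans h3)
    · exact Or.inl (h1.trans_eq h3)
    · exact Or.inl (h1.trans_lt h3)
    · exact Or.inr ⟨h1.trans h3, hs.trans x y z h2 h4⟩
  · intro x y
    rcases lt_trichotomy (h x) (h y) with hh | hh | hh
    · exact Or.inl (Or.inl hh)
    · exact (hs.total x y).imp (fun h' => Or.inr ⟨hh, h'⟩) fun h' => Or.inr ⟨hh.symm, h'⟩
    · exact Or.inr (Or.inl hh)
  · intro b y hb
    have h1 : r b + 1 ≤ h (e b) :=
      Finset.le_sup (f := fun b => r b + 1) (Finset.mem_filter.2 ⟨Finset.mem_univ b, le_rfl⟩)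
    have h2 : h y ≤ r b := Finset.sup_le fun b' hb' => hb b' (Finset.mem_filter.1 hb').2
    omega

/-- A finite nonempty family of linear extensions that reverses all pairs bounds the dimension. -/
theorem posetDim_le_card {α ι : Type*} [PartialOrder α] [Fintype ι] [Nonempty ι]
    (L : ι → α → α → Prop) (hL : ∀ i, IsLinearExtension α (L i))
    (h : ∀ x y, ¬ x ≤ y → ∃ i, ¬ L i x y) : posetDim α ≤ Fintype.card ι := by
  refine Nat.sInf_le ⟨Fintype.card_pos, fun i => L ((Fintype.equivFin ι).symm i), fun i => hL _,
    fun x y => ⟨fun hxy i => (hL _).extends_le x y hxy, fun hxy => ?_⟩⟩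
  by_contra hn
  obtain ⟨i, hi⟩ := h x y hn
  exact hi (by simpa using hxy (Fintype.equivFin ι i))

/-- The dimension of a finite poset is attained. -/
theorem posetDim_spec (α : Type*) [PartialOrder α] [Finite α] :
    0 < posetDim α ∧ ∃ L : Fin (posetDim α) → α → α → Prop, IsRealizer α L :=
  Nat.sInf_mem (exists_isRealizer α)

open Classical in
/-- The number of failures of a monotone property below `k` is the least number with it. -/
theorem card_filter_not_eq_find {p : ℕ → Prop} (hp : ∀ s t, s ≤ t → p s → p t) {k : ℕ}
    (hk : p k) : ((Finset.range k).filter fun t => ¬ p t).card = Nat.find ⟨k, hk⟩ := by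
  have : (Finset.range k).filter (fun t => ¬ p t) = Finset.range (Nat.find ⟨k, hk⟩) := by
    ext t
    simp only [Finset.mem_filter, Finset.mem_range, Nat.lt_find_iff]
    refine ⟨fun h s hs hps => h.2 (hp s t hs hps), fun h => ⟨?_, h t le_rfl⟩⟩
    by_contra hkt
    exact h k (not_lt.1 hkt) hk
  rw [this, Finset.card_range]

/-- The digit of weight `2 ^ (w * j)` of `c` in base `2 ^ w`. -/
def digit (w c j : ℕ) : ℕ := c / 2 ^ (w * j) % 2 ^ w

/-- Every finite sequence of digits is the beginning of the expansion of some number. -/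
theorem exists_digit_eq (w m : ℕ) (g : ℕ → ℕ) (hg : ∀ j < m, g j < 2 ^ w) :
    ∃ c < 2 ^ (w * m), ∀ j < m, digit w c j = g j := by
  -- This equivalence is the expansion in base `2 ^ w` with `m` digits.
  refine ⟨finFunctionFinEquiv (m := 2 ^ w) (n := m) fun j => ⟨g j, hg j j.2⟩, ?_, fun j hj => ?_⟩
  · rw [pow_mul]; exact Fin.is_lt _
  · have := congrArg (fun f => (f ⟨j, hj⟩ : ℕ)) ((finFunctionFinEquiv (m := 2 ^ w)
      (n := m)).symm_apply_apply fun j => ⟨g j, hg j j.2⟩)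
    rw [digit, pow_mul]
    exact this

/-! ### The blockwise approximation of the dimension -/

namespace FinitePoset

/-- The order of a finite poset as a relation on numbers. -/
def leNat (P : FinitePoset) (i j : ℕ) : Prop :=
  ∃ (hi : i < P.card) (hj : j < P.card), P.order.le ⟨i, hi⟩ ⟨j, hj⟩

/-- The functions `r 0, …, r (t - 1)` on the `q`-th block of `k` elements give rise to linear
extensions that reverse all pairs starting in the block. -/
def BlockReversed (P : FinitePoset) (k q t : ℕ) (r : ℕ → ℕ → ℕ) : Prop :=
  ∀ y < P.card, ∀ b < k, q * k + b < P.card → ¬ P.leNat (q * k + b) y →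
    ∃ i < t, ∀ b' < k, q * k + b' < P.card → P.leNat (q * k + b') y → r i b' < r i b

/-- Some number below `N` is the code of functions as in `BlockReversed`. -/
def BlockGood (P : FinitePoset) (N w k q t : ℕ) : Prop :=
  ∃ c < N, P.BlockReversed k q t fun i b => digit w c (i * k + b)

open Classical in
/-- The approximation to the dimension. -/
noncomputable def approxDim (P : FinitePoset) (N w k : ℕ) : ℕ :=
  ∑ q ∈ Finset.range P.card, ((Finset.range k).filter fun t => ¬ P.BlockGood N w k q t).card + 1

theorem BlockReversed.mono {P : FinitePoset} {k q s t : ℕ} {r : ℕ → ℕ → ℕ} (hst : s ≤ t)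
    (h : P.BlockReversed k q s r) : P.BlockReversed k q t r := fun y hy b hb hq hn =>
  let ⟨i, hi, h'⟩ := h y hy b hb hq hn
  ⟨i, hi.trans_le hst, h'⟩

/-- The `k * k` digits of a code form a table of ranks with row `i` at positions `i * k + b`. Since
`t ≤ k`, the codes below `2 ^ (w * (k * k))` exhaust all choices. -/
theorem BlockReversed.blockGood {P : FinitePoset} {N w k q t : ℕ} {r : ℕ → ℕ → ℕ}
    (h : P.BlockReversed k q t r) (hN : 2 ^ (w * (k * k)) ≤ N) (ht : t ≤ k)
    (hr : ∀ i < k, ∀ b < k, r i b < 2 ^ w) : P.BlockGood N w k q t := by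
  have hlt : ∀ i < k, ∀ b < k, i * k + b < k * k := fun i hi b hb => by nlinarith
  obtain ⟨c, hc, hd⟩ := exists_digit_eq w (k * k) (fun j => r (j / k) (j % k)) fun j hj =>
    hr _ (Nat.div_lt_of_lt_mul hj) _ (Nat.mod_lt _ (Nat.pos_of_mul_pos_right (by omega : 0 < k * k)))
  have hd' : ∀ i < k, ∀ b < k, digit w c (i * k + b) = r i b := fun i hi b hb => by
    rw [hd _ (hlt i hi b hb), mul_comm i k, Nat.mul_add_div (by omega), Nat.div_eq_of_lt hb,
      Nat.mul_add_mod, Nat.mod_eq_of_lt hb, add_zero]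
  refine ⟨c, hc.trans_le hN, fun y hy b hb hq hn => ?_⟩
  obtain ⟨i, hi, h'⟩ := h y hy b hb hq hn
  refine ⟨i, hi, fun b' hb' hq' hl => ?_⟩
  simp only [hd' i (by omega) b hb, hd' i (by omega) b' hb']
  exact h' b' hb' hq' hl

/-- One function per block element, namely its indicator: if `b` is not below `y`, all block members
below `y` have rank `0 < 1`. One bit per rank is enough. -/
theorem blockGood_self (P : FinitePoset) {N w k : ℕ} (q : ℕ) (hw : 0 < w)
    (hN : 2 ^ (w * (k * k)) ≤ N) : P.BlockGood N w k q k := by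
  refine BlockReversed.blockGood (r := fun i b => if i = b then 1 else 0)
    (fun y hy b hb hq hn => ⟨b, hb, fun b' hb' hq' hl => ?_⟩) hN le_rfl fun i _ b _ => ?_
  · have : b ≠ b' := by rintro rfl; exact hn hl
    simp [this]
  · have := Nat.one_lt_two_pow hw.ne'
    split_ifs <;> omega

/-- Rank `b` in the `i`-th extension of an optimal realizer by the number of block members strictly
before it. If that extension puts `y` before `b`, every member below `y` precedes `b` and so ranks
lower. Ranks are less than `k ≤ 2 ^ w`. -/
theorem blockGood_dim (P : FinitePoset) {N w k : ℕ} (q : ℕ) (hkw : k ≤ 2 ^ w)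
    (hN : 2 ^ (w * (k * k)) ≤ N) (hdk : P.dim ≤ k) : P.BlockGood N w k q P.dim := by
  classical
  let _ := P.order
  obtain ⟨-, L, hL, hLe⟩ := posetDim_spec (Fin P.card)
  let M : ℕ → ℕ → ℕ → Prop := fun i x y => ∃ (hi : i < P.dim) (hx : x < P.card) (hy : y < P.card),
    L ⟨i, hi⟩ ⟨x, hx⟩ ⟨y, hy⟩
  refine BlockReversed.blockGood (r := fun i b => ((Finset.range k).filter fun b' =>
    M i (q * k + b') (q * k + b) ∧ b' ≠ b).card) ?_ hN hdk fun i _ b hb => ?_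
  · intro y hy b hb hq hn
    have hn' : ¬ P.order.le ⟨q * k + b, hq⟩ ⟨y, hy⟩ := fun h => hn ⟨hq, hy, h⟩
    rw [hLe] at hn'
    push Not at hn'
    obtain ⟨⟨i, hi⟩, hi'⟩ := hn'
    refine ⟨i, hi, fun b' hb' hq' ⟨_, _, hl⟩ => Finset.card_lt_card ?_⟩
    have hyb : L ⟨i, hi⟩ ⟨y, hy⟩ ⟨q * k + b, hq⟩ := ((hL _).total _ _).resolve_left hi'
    have hby : L ⟨i, hi⟩ ⟨q * k + b', hq'⟩ ⟨y, hy⟩ := (hL _).extends_le _ _ hl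
    have hbb : L ⟨i, hi⟩ ⟨q * k + b', hq'⟩ ⟨q * k + b, hq⟩ := (hL _).trans _ _ _ hby hyb
    have hne : b' ≠ b := by rintro rfl; exact hi' hby
    rw [Finset.ssubset_iff_of_subset]
    · refine ⟨b', ?_, by simp⟩
      rw [Finset.mem_filter, Finset.mem_range]
      exact ⟨hb', ⟨hi, hq', hq, hbb⟩, hne⟩
    · intro a ha
      rw [Finset.mem_filter, Finset.mem_range] at ha ⊢
      obtain ⟨hak, ⟨_, haq, _, hab⟩, hab'⟩ := ha
      refine ⟨hak, ⟨hi, haq, hq, (hL _).trans _ _ _ hab hbb⟩, ?_⟩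
      rintro rfl
      have := (hL _).antisymm _ _ hab hbb
      simp only [Fin.mk.injEq] at this
      omega
  · refine lt_of_lt_of_le ?_ hkw
    refine (Finset.card_lt_card (t := Finset.range k) ?_).trans_eq (Finset.card_range k)
    rw [Finset.ssubset_iff_of_subset (Finset.filter_subset _ _)]
    exact ⟨b, Finset.mem_range.2 hb, by simp⟩

open Classical in
theorem blockGood_card (P : FinitePoset) {N w k : ℕ} (q : ℕ) (hw : 0 < w)
    (hN : 2 ^ (w * (k * k)) ≤ N) :
    P.BlockGood N w k q ((Finset.range k).filter fun t => ¬ P.BlockGood N w k q t).card := by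
  rw [card_filter_not_eq_find (p := P.BlockGood N w k q)
    (fun s t hst ⟨c, hc, h⟩ => ⟨c, hc, h.mono hst⟩) (P.blockGood_self q hw hN)]
  exact Nat.find_spec (p := P.BlockGood N w k q) _

open Classical in
theorem card_le_of_blockGood (P : FinitePoset) {N w k : ℕ} (q : ℕ) (hw : 0 < w)
    (hN : 2 ^ (w * (k * k)) ≤ N) {t : ℕ} (h : P.BlockGood N w k q t) :
    ((Finset.range k).filter fun t => ¬ P.BlockGood N w k q t).card ≤ t := by
  rw [card_filter_not_eq_find (p := P.BlockGood N w k q)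
    (fun s t hst ⟨c, hc, h⟩ => ⟨c, hc, h.mono hst⟩) (P.blockGood_self q hw hN)]
  exact Nat.find_min' _ h

/-- Each `x` lies in block `x / k` at place `x % k`, so any pair `x ≰ y` is reversed by an extension
built from the optimal rank functions of that block. -/
theorem dim_le_approxDim (P : FinitePoset) {N w k : ℕ} (hw : 0 < w) (hk : 0 < k)
    (hN : 2 ^ (w * (k * k)) ≤ N) : P.dim ≤ P.approxDim N w k := by
  classical
  let _ := P.order
  set m : ℕ → ℕ := fun q => ((Finset.range k).filter fun t => ¬ P.BlockGood N w k q t).card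
    with hm
  have hgood : ∀ q, P.BlockGood N w k q (m q) := fun q => P.blockGood_card q hw hN
  choose c hc hrev using hgood
  let e : ∀ q : ℕ, {b : Fin k // q * k + b < P.card} → Fin P.card := fun q b => ⟨_, b.2⟩
  choose L hL hLrev using fun (q i : ℕ) => exists_linearExtension_of_rank (e q)
    fun b => digit w (c q) (i * k + b.1)
  -- This extra extension accounts for the `+ 1` in `approxDim`. It keeps the family nonempty when
  -- no block needs any function, as for a single element.
  obtain ⟨s, hs, -⟩ := exists_linearExtension_of_rank (α := Fin P.card) Empty.elim Empty.elim
  let F : Option (Σ q : Fin P.card, Fin (m q)) → Fin P.card → Fin P.card → Prop := fun o =>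
    o.elim s fun a => L a.1 a.2
  have hF : ∀ o, IsLinearExtension (Fin P.card) (F o) := by
    rintro (_ | a)
    · exact hs
    · exact hL _ _
  have hcard : Fintype.card (Option (Σ q : Fin P.card, Fin (m q))) = P.approxDim N w k := by
    rw [Fintype.card_option, Fintype.card_sigma, approxDim, ← Fin.sum_univ_eq_sum_range]
    simp [hm]
  rw [← hcard]
  refine posetDim_le_card F hF fun x y hxy => ?_
  have hx : (x : ℕ) / k * k + x % k = x := Nat.div_add_mod' _ _
  have hb : (x : ℕ) % k < k := Nat.mod_lt _ hk
  obtain ⟨i, hi, h⟩ := hrev (x / k) y y.2 (x % k) hb (by omega) (by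
    rw [hx]
    exact fun ⟨_, _, h⟩ => hxy h)
  refine ⟨some ⟨⟨x / k, (Nat.div_le_self _ _).trans_lt x.2⟩, ⟨i, hi⟩⟩, ?_⟩
  have := hLrev (x / k) i ⟨⟨x % k, hb⟩, by simp only [hx]; exact x.2⟩ y fun b' hb' =>
    h b'.1 b'.1.2 b'.2 ⟨b'.2, y.2, hb'⟩
  have hex : e (x / k) ⟨⟨x % k, hb⟩, by simp only [hx]; exact x.2⟩ = x := Fin.ext hx
  rw [hex] at this
  exact this

/-- At most `n / k + 1` blocks are nonempty and each contributes at most `dim`; the extra `1` is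
absorbed by `1 ≤ dim`. -/
theorem approxDim_le (P : FinitePoset) {N w k : ℕ} (hw : 0 < w) (hk : 0 < k) (hkw : k ≤ 2 ^ w)
    (hN : 2 ^ (w * (k * k)) ≤ N) : P.approxDim N w k ≤ (P.card / k + 2) * P.dim := by
  classical
  have hpos : 0 < P.dim := by let _ := P.order; exact (posetDim_spec (Fin P.card)).1
  have hq : ∀ q, ((Finset.range k).filter fun t => ¬ P.BlockGood N w k q t).card ≤
      if q * k < P.card then P.dim else 0 := by
    intro q
    split_ifs with h
    · rcases le_total P.dim k with hd | hd
      · exact P.card_le_of_blockGood q hw hN (P.blockGood_dim q hkw hN hd)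
      -- When `dim` is at least `k`, the trivial bound `k` on the contribution suffices.
      · exact (Finset.card_filter_le _ _).trans (by rwa [Finset.card_range])
    -- The block is empty, so no function is needed and any code will do.
    · exact P.card_le_of_blockGood q hw hN
        ⟨0, (Nat.two_pow_pos _).trans_le hN, fun y hy b hb hq => absurd hq (by omega)⟩
  have hcount : ((Finset.range P.card).filter fun q => q * k < P.card).card ≤ P.card / k + 1 := by
    refine (Finset.card_le_card (t := Finset.range (P.card / k + 1)) fun q hq' => ?_).trans_eq
      (Finset.card_range _)
    rw [Finset.mem_filter] at hq'
    rw [Finset.mem_range, Nat.lt_succ_iff, Nat.le_div_iff_mul_le hk]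
    exact hq'.2.le
  have hsum := Finset.sum_le_sum fun q (_ : q ∈ Finset.range P.card) => hq q
  rw [← Finset.sum_filter, Finset.sum_const, smul_eq_mul] at hsum
  have := Nat.mul_le_mul_right P.dim hcount
  rw [approxDim]
  nlinarith

end FinitePoset

/-! ### The block size and the approximation ratio -/

/-- The binary logarithm of the length of the input, rounded down. -/
def logLength (N : ℕ) : ℕ := N.size - 1

/-- The number of bits of a rank. -/
def rankBits (N : ℕ) : ℕ := (logLength N).size

/-- The number of elements in a block. -/
def blockSize (N : ℕ) : ℕ := Nat.sqrt (logLength N / rankBits N)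

theorem logLength_pos {N : ℕ} (hN : 2 ≤ N) : 0 < logLength N := by
  have : 1 < N.size := Nat.lt_size.2 (by omega)
  unfold logLength; omega

theorem two_pow_logLength_le {N : ℕ} (hN : 2 ≤ N) : 2 ^ logLength N ≤ N := by
  have := logLength_pos hN
  exact Nat.lt_size.1 (by unfold logLength at *; omega)

theorem logLength_lt {N : ℕ} (hN : 2 ≤ N) : logLength N < N :=
  Nat.lt_two_pow_self.trans_le (two_pow_logLength_le hN)

theorem rankBits_pos {N : ℕ} (hN : 2 ≤ N) : 0 < rankBits N := Nat.size_pos.2 (logLength_pos hN)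

theorem rankBits_le (N : ℕ) : rankBits N ≤ logLength N := Nat.size_le.2 Nat.lt_two_pow_self

theorem blockSize_pos {N : ℕ} (hN : 2 ≤ N) : 0 < blockSize N :=
  Nat.sqrt_pos.2 (Nat.div_pos (rankBits_le N) (rankBits_pos hN))

theorem blockSize_le (N : ℕ) : blockSize N ≤ logLength N :=
  (Nat.sqrt_le_self _).trans (Nat.div_le_self _ _)

theorem blockSize_le_two_pow (N : ℕ) : blockSize N ≤ 2 ^ rankBits N :=
  (blockSize_le N).trans (Nat.lt_size_self _).le

/-- The reason for the choice of `blockSize`: the codes of a block number at most `2 ^ logLength N ≤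
N`. -/
theorem rankBits_mul_le (N : ℕ) : rankBits N * (blockSize N * blockSize N) ≤ logLength N :=
  (Nat.mul_le_mul_left _ (Nat.sqrt_le _)).trans (Nat.mul_div_le _ _)

/-- Maximality of the square root; this is the lower bound on the block size behind the ratio. -/
theorem logLength_lt_mul {N : ℕ} (hN : 2 ≤ N) :
    logLength N < (blockSize N + 1) * (blockSize N + 1) * rankBits N :=
  (Nat.div_lt_iff_lt_mul (rankBits_pos hN)).1 (Nat.sqrt_lt.1 (Nat.lt_succ_self _))

/-- The length of the word for a poset on `n` elements. -/
def inputLength (n : ℕ) : ℕ := n * n + n + 1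

/-- The approximation ratio. -/
def ratio (n : ℕ) : ℕ := n / blockSize (inputLength n) + 2

theorem log_le_logLength {n : ℕ} (hn : 1 ≤ Real.log n) :
    Real.log n ≤ logLength (inputLength n) := by
  have hn0 : 0 < (n : ℝ) := by
    rcases Nat.eq_zero_or_pos n with rfl | h
    · norm_num at hn
    · exact_mod_cast h
  have h1 : n ^ 2 ≤ 2 ^ (logLength (inputLength n) + 1) := by
    have h := Nat.lt_size_self (inputLength n)
    have h' := Nat.pow_le_pow_right (n := 2) two_pos
      (show (inputLength n).size ≤ logLength (inputLength n) + 1 by unfold logLength; omega)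
    have : n ^ 2 ≤ inputLength n := by unfold inputLength; nlinarith
    omega
  have h2 : (n : ℝ) ^ 2 ≤ 2 ^ (logLength (inputLength n) + 1) := by exact_mod_cast h1
  have h3 := Real.log_le_log (by positivity) h2
  rw [Real.log_pow, Real.log_pow] at h3
  push_cast at h3
  have := Real.log_two_lt_d9
  have h4 : (0 : ℝ) ≤ logLength (inputLength n) := by positivity
  nlinarith

/-- From `N ≤ n ^ 4` follows `L ≤ 8 log n`, and `2 ^ (w - 1) ≤ L` then gives `w ≤ 4 + log log n /
log 2`; the factor 9 is generous. -/
theorem rankBits_le_loglog {n : ℕ} (hn : 1 ≤ Real.log n) (hn' : 1 ≤ Real.log (Real.log n)) :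
    (rankBits (inputLength n) : ℝ) ≤ 9 * Real.log (Real.log n) := by
  set L := logLength (inputLength n) with hL
  have hn2 : 2 ≤ n := by
    by_contra h
    have : n = 0 ∨ n = 1 := by omega
    rcases this with rfl | rfl <;> norm_num at hn
  have hN : 2 ≤ inputLength n := by unfold inputLength; omega
  have hLpos : 0 < L := logLength_pos hN
  have hlog2 := Real.log_two_gt_d9
  have hlog2' := Real.log_two_lt_d9
  have h1 : 2 ^ L ≤ n ^ 4 := by
    refine (two_pow_logLength_le hN).trans ?_
    have h4 : 4 ≤ n ^ 2 := by nlinarith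
    have : n ^ 4 = n ^ 2 * n ^ 2 := by ring
    unfold inputLength
    nlinarith
  have h2 : (2 : ℝ) ^ L ≤ (n : ℝ) ^ 4 := by exact_mod_cast h1
  have h3 := Real.log_le_log (by positivity) h2
  rw [Real.log_pow, Real.log_pow] at h3
  push_cast at h3
  have hL8 : (L : ℝ) ≤ 8 * Real.log n := by
    have : (0 : ℝ) ≤ L := by positivity
    nlinarith
  have h4 : 2 ^ (rankBits (inputLength n) - 1) ≤ L :=
    Nat.lt_size.1 (Nat.sub_lt (rankBits_pos hN) one_pos)
  have h5 : (2 : ℝ) ^ (rankBits (inputLength n) - 1) ≤ 8 * Real.log n :=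
    le_trans (by exact_mod_cast h4) hL8
  have h6 := Real.log_le_log (by positivity) h5
  rw [Real.log_pow, Real.log_mul (by norm_num) (by linarith), Nat.cast_sub (rankBits_pos hN),
    show (8 : ℝ) = 2 ^ 3 by norm_num, Real.log_pow] at h6
  push_cast at h6
  have h7 : (1 : ℝ) ≤ rankBits (inputLength n) := by exact_mod_cast rankBits_pos hN
  nlinarith

theorem ratio_isBigO : (fun n => (ratio n : ℝ)) =O[Filter.atTop]
    fun n : ℕ => (n : ℝ) * Real.sqrt (Real.log (Real.log (n : ℝ))) /
      Real.sqrt (Real.log (n : ℝ)) := by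
  have hlog : Filter.Tendsto (fun n : ℕ => Real.log n) Filter.atTop Filter.atTop :=
    Real.tendsto_log_atTop.comp tendsto_natCast_atTop_atTop
  -- Here 8 = 6 + 2: 6 from `n / k`, and 2 from the summand `2` of `ratio`.
  refine Asymptotics.IsBigO.of_bound 8 ?_
  filter_upwards [hlog.eventually_ge_atTop 1,
    (Real.tendsto_log_atTop.comp hlog).eventually_ge_atTop 1,
    Filter.eventually_ge_atTop 1] with n h1 h2 hn
  simp only [Function.comp_apply] at h2
  have hN : 2 ≤ inputLength n := by unfold inputLength; omega
  have hk : (1 : ℝ) ≤ blockSize (inputLength n) := by exact_mod_cast blockSize_pos hN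
  have hL := log_le_logLength h1
  have hw := rankBits_le_loglog h1 h2
  have hk2 : (logLength (inputLength n) : ℝ) <
      (blockSize (inputLength n) + 1) * (blockSize (inputLength n) + 1) *
        rankBits (inputLength n) := by exact_mod_cast logLength_lt_mul hN
  set k : ℝ := (blockSize (inputLength n) : ℝ) with hkdef
  set l := Real.log n with hl
  set m := Real.log l with hm
  have hsl : 0 < √l := Real.sqrt_pos.2 (by linarith)
  have hsm : 1 ≤ √m := Real.one_le_sqrt.2 h2
  -- `l ≤ L < (k + 1)² w ≤ 4 k² · 9 m = (6 k)² m`.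
  have key : √l ≤ 6 * k * √m := by
    rw [Real.sqrt_le_left (by positivity), mul_pow, Real.sq_sqrt (by linarith)]
    have : (k + 1) * (k + 1) ≤ 4 * (k * k) := by nlinarith
    have h3 : (k + 1) * (k + 1) * rankBits (inputLength n) ≤ 4 * (k * k) * (9 * m) :=
      mul_le_mul this hw (by positivity) (by positivity)
    nlinarith
  have hn0 : (0 : ℝ) ≤ n := by positivity
  have hln : √l ≤ n := by
    have : l ≤ n := Real.log_le_self hn0
    refine le_trans ?_ this
    rw [Real.sqrt_le_left (by linarith)]
    nlinarith
  have e1 : (n : ℝ) / k ≤ 6 * (n * √m / √l) := by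
    rw [div_le_iff₀ (by linarith), mul_comm, ← mul_assoc, ← mul_div_assoc, le_div_iff₀ hsl]
    nlinarith [mul_le_mul_of_nonneg_left key hn0]
  have e2 : (1 : ℝ) ≤ n * √m / √l := by
    rw [le_div_iff₀ hsl]
    nlinarith
  rw [Real.norm_of_nonneg (by positivity), Real.norm_of_nonneg (by positivity), ratio]
  have e3 : ((n / blockSize (inputLength n) : ℕ) : ℝ) ≤ n / k := Nat.cast_div_le
  push_cast
  linarith

/-! ### The encoding of posets -/

namespace FinitePoset

theorem length_encode (P : FinitePoset) : P.encode.length = inputLength P.card := by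
  simp [encode, inputLength, List.length_flatMap]
  ring

theorem input_arr_of_lt (P : FinitePoset) {y : ℕ} (hy : y < P.card) :
    (RAM.input P.encode).arr 0 y = 1 := by
  simp only [RAM.input, encode, if_true]
  rw [List.getD_append _ _ _ _ (by simpa using hy), List.getD_eq_getElem _ _ (by simpa using hy)]
  simp

theorem input_arr_card (P : FinitePoset) : (RAM.input P.encode).arr 0 P.card = 0 := by
  simp [RAM.input, encode]

open Classical in
theorem input_arr_order (P : FinitePoset) {i j : ℕ} (hi : i < P.card) (hj : j < P.card) :
    (RAM.input P.encode).arr 0 (P.card + 1 + (i * P.card + j)) = if P.leNat i j then 1 else 0 := by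
  have hlt : i * P.card + j < P.card * P.card := by nlinarith
  -- Position `a` of the flattened matrix is row `a / n`, column `a % n`.
  have hflat : ((List.finRange P.card).flatMap fun i =>
      (List.finRange P.card).map fun j => decide (P.order.le i j)) =
      List.ofFn fun a : Fin (P.card * P.card) => decide (P.leNat (a / P.card) (a % P.card)) := by
    rw [List.ofFn_mul, List.flatMap, ← List.ofFn_eq_map]
    congr 1
    refine congrArg List.ofFn (funext fun i => ?_)
    rw [← List.ofFn_eq_map]
    refine congrArg List.ofFn (funext fun j => ?_)
    have hdiv : ((i : ℕ) * P.card + j) / P.card = i := by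
      rw [mul_comm, Nat.mul_add_div P.card_pos, Nat.div_eq_of_lt j.2, add_zero]
    have hmod : ((i : ℕ) * P.card + j) % P.card = j := by
      rw [mul_comm, Nat.mul_add_mod, Nat.mod_eq_of_lt j.2]
    simp [hdiv, hmod, leNat]
  have hdiv : (i * P.card + j) / P.card = i := by
    rw [mul_comm, Nat.mul_add_div P.card_pos, Nat.div_eq_of_lt hj, add_zero]
  have hmod : (i * P.card + j) % P.card = j := by
    rw [mul_comm, Nat.mul_add_mod, Nat.mod_eq_of_lt hj]
  have : (RAM.input P.encode).arr 0 (P.card + 1 + (i * P.card + j)) =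
      (decide (P.leNat i j)).toNat := by
    simp only [RAM.input, encode, if_true, hflat]
    rw [List.getD_append_right _ _ _ _ (by simp; omega), List.length_replicate,
      show P.card + 1 + (i * P.card + j) - P.card = (i * P.card + j) + 1 by omega,
      List.getD_cons_succ, List.getD_eq_getElem _ _ (by simpa using hlt), List.getElem_ofFn]
    simp only [hdiv, hmod]
  rw [this]
  split_ifs with h <;> simp [h]

end FinitePoset

/-! ### The algorithm as a term and as a program -/

namespace RAM

namespace Term

/-- A term for the number of leading ones of the array `0`. -/
def leadingOnes : Term :=
  sum 9 (var 0) (all 10 (add (var 10) (const 1)) (le (const 1) (get 0 (var 11))))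

/-- Counts the `x` with nonzero entries at `0, …, x`; the separator `0` at position `n` stops the
count, which recovers the size of the poset. -/
theorem eval_leadingOnes {s : Store} {n : ℕ} (hn : n < s.var 0) (h1 : ∀ y < n, s.arr 0 y = 1)
    (h0 : s.arr 0 n = 0) : leadingOnes.eval s = n := by
  classical
  rw [leadingOnes, eval_sum_of_holds (m := s.var 0) (φ := fun x => ∀ y < x + 1, 1 ≤ s.arr 0 y)
    (by simp [eval])]
  · rw [show (Finset.range (s.var 0)).filter (fun x => ∀ y < x + 1, 1 ≤ s.arr 0 y) =
      Finset.range n from ?_, Finset.card_range]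
    ext x
    simp only [Finset.mem_filter, Finset.mem_range]
    refine ⟨fun ⟨_, h⟩ => ?_, fun hx => ⟨hx.trans hn, fun y hy => (h1 y (by omega)).ge⟩⟩
    by_contra hnx
    have := h n (by omega)
    omega
  · intro x hx
    refine Holds.all (by simp [eval, Store.setVar_var]; omega) fun y hy => ?_
    simpa [eval, Store.setVar_var] using holds_le (const 1) (get 0 (var 11))
      ((s.setVar (9 + 1) x).setVar (10 + 1) y)

/-- A term for the number of binary digits, based on a table of powers of two. -/
def size (t : Term) : Term := sum t.bd (var 0) (le (get 1 (var (t.bd + 1))) t)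

theorem eval_size (t : Term) {s : Store} (hT : ∀ j ≤ s.var 0, s.arr 1 j = 2 ^ j)
    (ht : t.eval s ≤ s.var 0) : (size t).eval s = (t.eval s).size := by
  rw [size, eval_sum_of_holds (m := s.var 0) (φ := fun j => 2 ^ j ≤ t.eval s) (by simp [eval])]
  · rw [show (Finset.range (s.var 0)).filter (fun j => 2 ^ j ≤ t.eval s) =
      Finset.range (t.eval s).size from ?_, Finset.card_range]
    ext j
    simp only [Finset.mem_filter, Finset.mem_range, Nat.lt_size]
    refine ⟨fun h => h.2, fun h => ⟨?_, h⟩⟩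
    exact (Nat.lt_two_pow_self.trans_le h).trans_le ht
  · intro j hj
    have := holds_le (get 1 (var (t.bd + 1))) t (s.setVar (t.bd + 1) j)
    rw [t.eval_setVar s (Nat.le_succ _)] at this
    simpa [eval, Store.setVar_var, hT j hj.le] using this

/-- A term for the size of the blocks. -/
def blockSize : Term :=
  sum 9 (var 0) (le (mul (add (var 10) (const 1)) (mul (add (var 10) (const 1)) (var 3))) (var 2))

/-- The root is the number of `x` with `(x + 1)² w ≤ L`, so no square root is computed. -/
theorem eval_blockSize {s : Store} (hN : 2 ≤ s.var 0) (h2 : s.var 2 = logLength (s.var 0))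
    (h3 : s.var 3 = rankBits (s.var 0)) : blockSize.eval s = _root_.blockSize (s.var 0) := by
  rw [blockSize, eval_sum_of_holds (m := s.var 0)
    (φ := fun x => (x + 1) * ((x + 1) * s.var 3) ≤ s.var 2) (by simp [eval])]
  · rw [show (Finset.range (s.var 0)).filter (fun x => (x + 1) * ((x + 1) * s.var 3) ≤ s.var 2) =
      Finset.range (_root_.blockSize (s.var 0)) from ?_, Finset.card_range]
    ext x
    simp only [Finset.mem_filter, Finset.mem_range]
    have h : (x + 1) * ((x + 1) * s.var 3) ≤ s.var 2 ↔ x < _root_.blockSize (s.var 0) := by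
      rw [← mul_assoc, h2, h3, ← Nat.le_div_iff_mul_le (rankBits_pos hN), ← Nat.le_sqrt]
      rfl
    rw [h]
    have := blockSize_le (s.var 0)
    have := logLength_lt hN
    omega
  · intro x hx
    have := holds_le (mul (add (var 10) (const 1)) (mul (add (var 10) (const 1)) (var 3))) (var 2)
      (s.setVar (9 + 1) x)
    rw [eval_mul _ _ _ (by simp [eval, Store.setVar_var]; omega),
      eval_mul _ _ _ (by simp [eval, Store.setVar_var]; omega)] at this
    simpa [eval, Store.setVar_var] using this

/-- A term for the element with number `x` of the current block. -/
def elt (x : ℕ) : Term := add (mul (var 10) (var 4)) (var x)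

/-- In the terms below, variables 1, 3, 4 hold `n`, `w`, `k`, and variables 10 to 16 hold the block
`q`, the number `t`, the code `c`, then `y`, `b`, `i`, `b'`. -/
theorem eval_elt (x : ℕ) {s : Store} (h : s.var 10 ≤ s.var 0) :
    (elt x).eval s = s.var 10 * s.var 4 + s.var x := by
  simp only [elt, eval]
  rw [eval_mul (var 10) _ _ h]
  rfl

/-- A term for the order relation. -/
def rel (x : ℕ) : Term :=
  lt (const 0) (get 0 (add (add (var 1) (const 1)) (add (mul (elt x) (var 1)) (var 13))))

theorem holds_rel (P : FinitePoset) (x : ℕ) {s : Store} (h0 : s.arr 0 = (input P.encode).arr 0)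
    (h1 : s.var 1 = P.card) (h : s.var 10 ≤ s.var 0) (hn : P.card ≤ s.var 0)
    (hx : s.var 10 * s.var 4 + s.var x < P.card) (hy : s.var 13 < P.card) :
    (rel x).Holds s (P.leNat (s.var 10 * s.var 4 + s.var x) (s.var 13)) := by
  classical
  have := holds_lt (const 0)
    (get 0 (add (add (var 1) (const 1)) (add (mul (elt x) (var 1)) (var 13)))) s
  simp only [eval] at this
  rw [eval_mul _ _ _ (by rw [eval_elt x h]; omega), eval_elt x h, h0] at this
  simp only [eval, h1] at this
  rw [P.input_arr_order hx hy] at this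
  have hiff : (0 < if P.leNat (s.var 10 * s.var 4 + s.var x) (s.var 13) then 1 else 0) ↔
      P.leNat (s.var 10 * s.var 4 + s.var x) (s.var 13) := by
    split_ifs with h <;> simp [h]
  rw [← propext hiff]
  exact this

/-- A term for a rank read off from the current code. -/
def rank (x : ℕ) : Term :=
  mod (div (var 12) (get 1 (mul (var 3) (add (mul (var 15) (var 4)) (var x))))) (get 1 (var 3))

theorem eval_rank (x : ℕ) {s : Store} (hT : ∀ j ≤ s.var 0, s.arr 1 j = 2 ^ j)
    (h3 : s.var 3 ≤ s.var 0) (h12 : s.var 12 ≤ s.var 0) (h15 : s.var 15 ≤ s.var 0)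
    (h : s.var 3 * (s.var 15 * s.var 4 + s.var x) ≤ s.var 0) :
    (rank x).eval s = digit (s.var 3) (s.var 12) (s.var 15 * s.var 4 + s.var x) := by
  have e1 : (get 1 (mul (var 3) (add (mul (var 15) (var 4)) (var x)))).eval s =
      2 ^ (s.var 3 * (s.var 15 * s.var 4 + s.var x)) := by
    simp only [eval]
    rw [eval_mul (var 3) _ _ h3]
    simp only [eval]
    rw [eval_mul (var 15) _ _ h15]
    exact hT _ h
  have e2 : (get 1 (var 3)).eval s = 2 ^ s.var 3 := hT _ h3
  have e3 := eval_div (var 12) (get 1 (mul (var 3) (add (mul (var 15) (var 4)) (var x)))) s h12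
    (by rw [e1]; positivity)
  rw [rank, eval_mod, e3, e1, e2]
  · rfl
  · rw [e3]; exact (Nat.div_le_self _ _).trans h12
  · rw [e2]; positivity

/-- A term for the question whether the current block can be handled by the current number of
linear extensions. -/
def blockGood : Term :=
  ex 11 (var 0) <| all 12 (var 1) <| all 13 (var 4) <| imp (lt (elt 14) (var 1)) <|
  imp (rel 14).not <| ex 14 (var 11) <| all 15 (var 4) <| imp (lt (elt 16) (var 1)) <|
  imp (rel 16) <| lt (rank 16) (rank 14)

/-- The store after the preparations. -/
structure Ready (P : FinitePoset) (s : Store) : Prop where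
  arr_zero : s.arr 0 = (input P.encode).arr 0
  arr_one : ∀ j ≤ s.var 0, s.arr 1 j = 2 ^ j
  var_zero : s.var 0 = inputLength P.card
  var_one : s.var 1 = P.card
  var_three : s.var 3 = rankBits (s.var 0)
  var_four : s.var 4 = _root_.blockSize (s.var 0)

theorem Ready.setVar {P : FinitePoset} {s : Store} (h : Ready P s) {x : ℕ} (hx : 5 ≤ x) (v : ℕ) :
    Ready P (s.setVar x v) := by
  obtain ⟨h1, h2, h3, h4, h5, h6⟩ := h
  have : ∀ y < 5, (s.setVar x v).var y = s.var y := fun y hy => by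
    rw [Store.setVar_var, if_neg (by omega)]
  constructor <;> simp_all

theorem Ready.holds_blockGood {P : FinitePoset} {s : Store} (hs : Ready P s)
    (hq : s.var 10 ≤ s.var 0) (ht : s.var 11 ≤ s.var 4) :
    blockGood.Holds s (P.BlockGood (s.var 0) (s.var 3) (s.var 4) (s.var 10) (s.var 11)) := by
  have hN : 2 ≤ s.var 0 := by
    have := P.card_pos
    rw [hs.var_zero, inputLength]
    omega
  have hn : P.card ≤ s.var 0 := by rw [hs.var_zero, inputLength]; omega
  have hw : s.var 3 ≤ s.var 0 := by
    rw [hs.var_three]; exact (rankBits_le _).trans (logLength_lt hN).le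
  have hk : s.var 4 ≤ s.var 0 := by
    rw [hs.var_four]; exact (blockSize_le _).trans (logLength_lt hN).le
  have hwk : s.var 3 * (s.var 4 * s.var 4) ≤ s.var 0 := by
    rw [hs.var_three, hs.var_four]; exact (rankBits_mul_le _).trans (logLength_lt hN).le
  -- All exponents of digit weights stay within the table of powers, as `i < t ≤ k`.
  have hidx : ∀ i < s.var 11, ∀ b < s.var 4, s.var 3 * (i * s.var 4 + b) ≤ s.var 0 :=
    fun i hi b hb => (Nat.mul_le_mul_left _ (by nlinarith)).trans hwk
  refine Holds.ex (by simp [eval]) fun c hc => ?_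
  refine Holds.all (by simpa [eval, Store.setVar_var, hs.var_one] using hn) fun y hy => ?_
  refine Holds.all (by simpa [eval, Store.setVar_var] using hk) fun b hb => ?_
  have hs1 := ((hs.setVar (x := 11 + 1) (by norm_num) c).setVar (x := 12 + 1) (by norm_num)
    y).setVar (x := 13 + 1) (by norm_num) b
  set s1 := ((s.setVar (11 + 1) c).setVar (12 + 1) y).setVar (13 + 1) b with hs1def
  have v1 : s1.var 0 = s.var 0 ∧ s1.var 3 = s.var 3 ∧ s1.var 4 = s.var 4 ∧
      s1.var 10 = s.var 10 ∧ s1.var 11 = s.var 11 ∧ s1.var 12 = c ∧ s1.var 13 = y ∧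
      s1.var 14 = b := by simp [hs1def, Store.setVar_var]
  clear_value s1
  obtain ⟨v0, v3, v4, v10, v11, v12, v13, v14⟩ := v1
  refine Holds.imp ?_ fun hbn => Holds.imp (Holds.not ?_) fun _ => ?_
  · have := holds_lt (elt 14) (var 1) s1
    rwa [eval_elt _ (by omega), v10, v4, v14, eval, hs1.var_one] at this
  · have := holds_rel P 14 hs1.arr_zero hs1.var_one (by omega) (by omega)
      (by rw [v10, v4, v14]; exact hbn) (by rw [v13]; exact hy)
    rwa [v10, v4, v14, v13] at this
  refine Holds.ex (by simp only [eval]; omega) fun i hi => ?_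
  refine Holds.all (by simp [eval, Store.setVar_var]; omega) fun b' hb' => ?_
  have hs2 := (hs1.setVar (x := 14 + 1) (by norm_num) i).setVar (x := 15 + 1) (by norm_num) b'
  set s2 := (s1.setVar (14 + 1) i).setVar (15 + 1) b' with hs2def
  have v2 : s2.var 0 = s.var 0 ∧ s2.var 3 = s.var 3 ∧ s2.var 4 = s.var 4 ∧
      s2.var 10 = s.var 10 ∧ s2.var 11 = s.var 11 ∧ s2.var 12 = c ∧ s2.var 13 = y ∧
      s2.var 14 = b ∧ s2.var 15 = i ∧ s2.var 16 = b' := by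
    simp [Store.setVar_var, *]
  clear_value s2
  obtain ⟨u0, u3, u4, u10, u11, u12, u13, u14, u15, u16⟩ := v2
  refine Holds.imp ?_ fun hbn' => Holds.imp ?_ fun _ => ?_
  · have := holds_lt (elt 16) (var 1) s2
    rwa [eval_elt _ (by omega), u10, u4, u16, eval, hs2.var_one] at this
  · have := holds_rel P 16 hs2.arr_zero hs2.var_one (by omega) (by omega)
      (by rw [u10, u4, u16]; exact hbn') (by rw [u13]; exact hy)
    rwa [u10, u4, u16, u13] at this
  · have := holds_lt (rank 16) (rank 14) s2
    rwa [eval_rank 16 hs2.arr_one (by omega) (by omega) (by omega)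
        (by rw [u3, u15, u4, u16, u0]; exact hidx i hi b' hb'),
      eval_rank 14 hs2.arr_one (by omega) (by omega) (by omega)
        (by rw [u3, u15, u4, u14, u0]; exact hidx i hi b hb),
      u3, u12, u15, u4, u16, u14] at this

/-- A term for the approximation to the dimension. -/
def approxDim : Term :=
  add (sum 9 (var 1) (sum 10 (var 4) blockGood.not)) (const 1)

theorem Ready.eval_approxDim {P : FinitePoset} {s : Store} (hs : Ready P s) :
    approxDim.eval s = P.approxDim (inputLength P.card) (rankBits (inputLength P.card))
      (_root_.blockSize (inputLength P.card)) := by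
  classical
  have hn : P.card ≤ s.var 0 := by rw [hs.var_zero, inputLength]; omega
  have hN : 2 ≤ s.var 0 := by
    have := P.card_pos
    rw [hs.var_zero, inputLength]
    omega
  have hk : s.var 4 ≤ s.var 0 := by
    rw [hs.var_four]; exact (blockSize_le _).trans (logLength_lt hN).le
  change ∑ q ∈ Finset.range (min (s.var 1) (s.var 0)),
    (sum 10 (var 4) blockGood.not).eval (s.setVar (9 + 1) q) + 1 = _
  rw [FinitePoset.approxDim]
  rw [hs.var_one, min_eq_left hn]
  refine congrArg (· + 1) (Finset.sum_congr rfl fun q hq => ?_)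
  rw [Finset.mem_range] at hq
  rw [← hs.var_zero, ← hs.var_three, ← hs.var_four]
  refine eval_sum_of_holds (by simpa [eval, Store.setVar_var] using hk) fun t ht => Holds.not ?_
  have := ((hs.setVar (x := 9 + 1) (by norm_num) q).setVar (x := 10 + 1) (by norm_num)
    t).holds_blockGood (by simp [Store.setVar_var]; omega) (by simp [Store.setVar_var]; omega)
  simpa [Store.setVar_var] using this

end Term

open Term in
/-- The approximation algorithm. -/
def approxDimProg : Prog :=
  .seq powTable <|
  -- Scratch variables start at 100, above every variable of the terms.
  .seq (assignProg 1 leadingOnes 100) <|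
  .seq (assignProg 2 (.sub (size (.var 0)) (.const 1)) 100) <|
  .seq (assignProg 3 (size (.var 2)) 100) <|
  .seq (assignProg 4 blockSize 100) <|
  assignProg 0 approxDim 100

open Term in
set_option maxRecDepth 4000 in
theorem polyTimeComputable_approxDim :
    PolyTimeComputable FinitePoset.encode fun P => P.approxDim (inputLength P.card)
      (rankBits (inputLength P.card)) (_root_.blockSize (inputLength P.card)) := by
  -- 30 = 20 for the table plus 2 for each of the five assignments.
  refine ⟨approxDimProg, 20 * Polynomial.X + 30 + leadingOnes.cost +
    (Term.sub (size (.var 0)) (.const 1)).cost + (size (.var 2)).cost + blockSize.cost +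
    approxDim.cost, fun P => ?_⟩
  have hN : 2 ≤ inputLength P.card := by
    have := P.card_pos
    unfold inputLength; omega
  have hlen : (input P.encode).var 0 = inputLength P.card := P.length_encode
  obtain ⟨m0, s0, x0, c0, a0, p0, z0⟩ := exec_powTable (input P.encode)
  rw [hlen] at c0 p0 z0
  obtain ⟨m1, s1, x1, c1, a1, v1, r1⟩ := exec_assignProg 1 leadingOnes s0 100 (by decide)
  rw [eval_leadingOnes (n := P.card) (by rw [z0]; unfold inputLength; omega)
    (fun y hy => by rw [a0]; exact P.input_arr_of_lt hy) (by rw [a0]; exact P.input_arr_card)] at r1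
  have z1 : s1.var 0 = inputLength P.card := (v1 0 (by norm_num) (by norm_num)).trans z0
  obtain ⟨m2, s2, x2, c2, a2, v2, r2⟩ := exec_assignProg 2
    (.sub (size (.var 0)) (.const 1)) s1 100 (by decide)
  rw [eval, eval_size _ (by rw [z1, a1]; exact p0) le_rfl, eval, eval, z1] at r2
  have z2 : s2.var 0 = inputLength P.card := (v2 0 (by norm_num) (by norm_num)).trans z1
  obtain ⟨m3, s3, x3, c3, a3, v3, r3⟩ := exec_assignProg 3 (size (.var 2)) s2 100 (by decide)
  rw [eval_size _ (by rw [z2, a2, a1]; exact p0)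
    (by rw [eval, r2, z2]; exact (logLength_lt hN).le), eval, r2] at r3
  have z3 : s3.var 0 = inputLength P.card := (v3 0 (by norm_num) (by norm_num)).trans z2
  obtain ⟨m4, s4, x4, c4, a4, v4, r4⟩ := exec_assignProg 4 blockSize s3 100 (by decide)
  rw [eval_blockSize (by rw [z3]; exact hN)
    (by rw [v3 2 (by norm_num) (by norm_num), r2, z3]; rfl) (by rw [r3, z3]; rfl), z3] at r4
  have z4 : s4.var 0 = inputLength P.card := (v4 0 (by norm_num) (by norm_num)).trans z3
  obtain ⟨m5, s5, x5, c5, -, -, r5⟩ := exec_assignProg 0 approxDim s4 100 (by decide)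
  have hready : Ready P s4 :=
    { arr_zero := by rw [a4, a3, a2, a1, a0]
      arr_one := by rw [a4, a3, a2, a1, z4]; exact p0
      var_zero := z4
      var_one := by
        rw [v4 1 (by norm_num) (by norm_num), v3 1 (by norm_num) (by norm_num),
          v2 1 (by norm_num) (by norm_num), r1]
      var_three := by rw [v4 3 (by norm_num) (by norm_num), r3, z4]; rfl
      var_four := by rw [r4, z4] }
  refine ⟨_, s5, .seq x0 (.seq x1 (.seq x2 (.seq x3 (.seq x4 x5)))), ?_,
    r5.trans hready.eval_approxDim⟩
  rw [P.length_encode]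
  rw [z0] at c1
  rw [z1] at c2
  rw [z2] at c3
  rw [z3] at c4
  rw [z4] at c5
  simp only [Polynomial.eval_add, Polynomial.eval_mul, Polynomial.eval_ofNat, Polynomial.eval_X]
  omega

end RAM

/-- There is a polynomial-time approximation algorithm for the dimension of an `n`-element poset
with approximation factor `O(n √(log log n) / √(log n))`. -/
theorem mainTheorem6 :
    ∃ (ρ : ℕ → ℝ) (f : FinitePoset → ℕ),
      Asymptotics.IsBigO Filter.atTop ρ
        (fun n : ℕ => (n : ℝ) * Real.sqrt (Real.log (Real.log (n : ℝ))) /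
          Real.sqrt (Real.log (n : ℝ))) ∧
      RAM.PolyTimeComputable FinitePoset.encode f ∧
      ∀ P : FinitePoset, P.dim ≤ f P ∧ (f P : ℝ) ≤ ρ P.card * (P.dim : ℝ) := by
  refine ⟨fun n => ratio n, _, ratio_isBigO, RAM.polyTimeComputable_approxDim, fun P => ?_⟩
  have hN : 2 ≤ inputLength P.card := by
    have := P.card_pos
    unfold inputLength; omega
  have hcodes : 2 ^ (rankBits (inputLength P.card) *
      (blockSize (inputLength P.card) * blockSize (inputLength P.card))) ≤ inputLength P.card :=
    (Nat.pow_le_pow_right two_pos (rankBits_mul_le _)).trans (two_pow_logLength_le hN)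
  refine ⟨P.dim_le_approxDim (rankBits_pos hN) (blockSize_pos hN) hcodes, ?_⟩
  have := P.approxDim_le (rankBits_pos hN) (blockSize_pos hN) (blockSize_le_two_pow _) hcodes
  simp only [ratio]
  exact_mod_cast this
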